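/- **Theorem.** Let $G$ be a connected undirected simple graph on the vertex set $V=\{0,\dots,N-1\}$ with adjacency matrix $A$, diagonal degree matrix $D$ and Laplacian $L=D-A$. Let $L^\dagger$ be the Moore–Penrose pseudo-inverse of $L$ and $L^{2\dagger}=(L^\dagger)^2$. The squared biharmonic distance between $j,k\in V$ is $$d_B^2(j,k)=L^{2\dagger}_{jj}+L^{2\dagger}_{kk}-2L^{2\dagger}_{jk},$$ the biharmonic vertex index of $j\in V$ is $D_B^2(j)=\sum_{k\in V}d_B^2(j,k)$, and the biharmonic Kirchhoff index of $G$ is $D_B^2(G)=\sum_{j,k\in V,\ j<k}d_B^2(j,k)$. Consider the noisy second-order consensus dynamics $$\begin{pmatrix}\dot x_1(t)\\ \dot x_2(t)\end{pmatrix}=\begin{pmatrix}0&I\\-L&-L\end{pmatrix}\begin{pmatrix}x_1(t)\\x_2(t)\end{pmatrix}+\begin{pmatrix}0\\I\end{pmatrix}w(t),\qquad t\ge 0,$$ where $x_1(t),x_2(t)\in\mathbb R^N$ and $w=\dot W$ is a vector of $N$ independent standard Gaussian white noises. That is, $W$ is a vector of $N$ independent standard Brownian motions and, almost surely, $x=(x_1,x_2)$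 has continuous paths and satisfies, for all $t\ge0$, $$x_1(t)=x_1(0)+\int_0^t x_2(s)\,ds,\qquad x_2(t)=x_2(0)-\int_0^t\big(Lx_1(s)+Lx_2(s)\big)\,ds+W(t).$$ Let the initial state $(x_1(0),x_2(0))$ have finite second moments, and let $\bar x_1(t)=\frac1N\sum_{k\in V}x_{1k}(t)$ be the network average. Then, for every vertex $j\in V$, the expectations $\mathbb E[(x_{1j}(t)-\bar x_1(t))^2]$ are finite, and the steady-state variance of the deviation of vertex $j$ from the network average, $H_{\mathrm{SO}}(j)=\lim_{t\to\infty}\mathbb E\big[(x_{1j}(t)-\bar x_1(t))^2\big]$, exists and equals $$H_{\mathrm{SO}}(j)=\frac1{2N}\left(D_B^2(j)-\frac1N D_B^2(G)\right).$$ -/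

import Mathlib

open MeasureTheory ProbabilityTheory Filter Topology
open scoped NNReal Matrix

noncomputable section

namespace Consensus

section Pinv

variable {n : Type*} [Fintype n] [DecidableEq n] {A : Matrix n n ℝ} (hA : A.IsHermitian)

/-- `U diag(dᵢ) Uᵀ`, where `A = U diag(λᵢ) Uᵀ` is the diagonalization of the symmetric `A`. -/
def spectralMatrix (d : n → ℝ) : Matrix n n ℝ :=
  (hA.eigenvectorUnitary : Matrix n n ℝ) * Matrix.diagonal d *
    (star hA.eigenvectorUnitary : Matrix n n ℝ)

/-- The Moore-Penrose pseudo-inverse `U diag(1/λᵢ) Uᵀ` of a real symmetric matrix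
`A = U diag(λᵢ) Uᵀ`, where `1/λᵢ` is read as `0` if `λᵢ = 0` (as `0⁻¹ = 0` in `ℝ`).
The four Penrose equations are proved below. -/
def pinv : Matrix n n ℝ :=
  spectralMatrix hA fun i => (hA.eigenvalues i)⁻¹

theorem eq_spectralMatrix : A = spectralMatrix hA hA.eigenvalues := by
  have h := hA.spectral_theorem
  rw [Unitary.conjStarAlgAut_apply] at h
  exact h

theorem spectralMatrix_mul (d e : n → ℝ) :
    spectralMatrix hA d * spectralMatrix hA e = spectralMatrix hA (fun i => d i * e i) := by
  have h : (star hA.eigenvectorUnitary : Matrix n n ℝ) *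
      (hA.eigenvectorUnitary : Matrix n n ℝ) = 1 := Unitary.coe_star_mul_self _
  unfold spectralMatrix
  rw [← Matrix.diagonal_mul_diagonal]
  simp only [Matrix.mul_assoc]
  rw [← Matrix.mul_assoc (star hA.eigenvectorUnitary : Matrix n n ℝ)
    (hA.eigenvectorUnitary : Matrix n n ℝ), h, Matrix.one_mul]

theorem transpose_spectralMatrix (d : n → ℝ) :
    (spectralMatrix hA d)ᵀ = spectralMatrix hA d := by
  have h : (spectralMatrix hA d)ᴴ = spectralMatrix hA d := by
    simp [spectralMatrix, Matrix.star_eq_conjTranspose, Matrix.mul_assoc]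
  rwa [Matrix.conjTranspose_eq_transpose_of_trivial] at h

theorem mul_pinv : A * pinv hA =
    spectralMatrix hA (fun i => hA.eigenvalues i * (hA.eigenvalues i)⁻¹) :=
  (congrArg (· * pinv hA) (eq_spectralMatrix hA)).trans (spectralMatrix_mul hA _ _)

theorem pinv_mul : pinv hA * A =
    spectralMatrix hA (fun i => (hA.eigenvalues i)⁻¹ * hA.eigenvalues i) :=
  (congrArg (pinv hA * ·) (eq_spectralMatrix hA)).trans (spectralMatrix_mul hA _ _)

theorem mul_pinv_mul : A * pinv hA * A = A := by
  rw [mul_pinv]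
  refine (congrArg (_ * ·) (eq_spectralMatrix hA)).trans
    (((spectralMatrix_mul hA _ _).trans ?_).trans (eq_spectralMatrix hA).symm)
  simp

theorem pinv_mul_pinv : pinv hA * A * pinv hA = pinv hA := by
  rw [pinv_mul, pinv, spectralMatrix_mul]
  congr 1
  funext i
  by_cases h : hA.eigenvalues i = 0
  · simp [h]
  · field_simp

theorem transpose_mul_pinv : (A * pinv hA)ᵀ = A * pinv hA := by
  rw [mul_pinv, transpose_spectralMatrix]

theorem transpose_pinv_mul : (pinv hA * A)ᵀ = pinv hA * A := by
  rw [pinv_mul, transpose_spectralMatrix]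

end Pinv

section Graph

variable {N : ℕ} (G : SimpleGraph (Fin N)) [DecidableRel G.Adj]

/-- The pseudo-inverse `L†` of the graph Laplacian `L = D - A`. -/
def lapPinv : Matrix (Fin N) (Fin N) ℝ :=
  pinv (G.posSemidef_lapMatrix ℝ).isHermitian

/-- The squared biharmonic distance
`d_B²(j,k) = (L†)²ⱼⱼ + (L†)²ₖₖ - 2 (L†)²ⱼₖ`. -/
def biharmonicDistSq (j k : Fin N) : ℝ :=
  (lapPinv G ^ 2) j j + (lapPinv G ^ 2) k k - 2 * (lapPinv G ^ 2) j k

/-- The biharmonic Kirchhoff index `D_B²(G)`, a sum over all pairs `j < k`. -/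
def biharmonicKirchhoffIndex : ℝ :=
  ∑ j : Fin N, ∑ k : Fin N with j < k, biharmonicDistSq G j k

/-- The biharmonic vertex index `D_B²(j)`. -/
def biharmonicVertexIndex (j : Fin N) : ℝ :=
  ∑ k : Fin N, biharmonicDistSq G j k

/-- The `2N × 2N` drift matrix `[[0, I], [-L, -L]]`. -/
def driftMatrix : Matrix (Fin N ⊕ Fin N) (Fin N ⊕ Fin N) ℝ :=
  Matrix.fromBlocks 0 1 (-(G.lapMatrix ℝ)) (-(G.lapMatrix ℝ))

/-- The `2N × N` noise matrix `[0; I]`. -/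
def noiseMatrix (N : ℕ) : Matrix (Fin N ⊕ Fin N) (Fin N) ℝ :=
  Matrix.fromRows 0 1

variable {Ω : Type*} [MeasurableSpace Ω]

/-- `W` is a vector of `N` independent standard Brownian motions: the time integral of `N`
uncorrelated (unit intensity) Gaussian white noises. -/
structure IsBrownianVector (W : Fin N → ℝ≥0 → Ω → ℝ) (P : Measure Ω) : Prop where
  isBrownian : ∀ j, IsBrownianReal (W j) P
  indep : iIndepFun (fun j ω t => W j t ω) P

/-- The process `x = (x₁, x₂)` solves the noisy second-order consensus dynamics
`ẋ = [[0, I], [-L, -L]] x + [0; I] w`, `w` being the white noise `dW/dt`. As the noise is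
additive, this is the integral equation
`x(t) = x(0) + ∫₀ᵗ [[0, I], [-L, -L]] x(s) ds + [0; I] W(t)` along almost every path. -/
structure IsSolution (x : ℝ≥0 → Ω → (Fin N ⊕ Fin N → ℝ)) (W : Fin N → ℝ≥0 → Ω → ℝ)
    (P : Measure Ω) : Prop where
  aemeasurable : ∀ t, AEMeasurable (x t) P
  continuous_paths : ∀ᵐ ω ∂P, Continuous (fun t => x t ω)
  integral_eq : ∀ᵐ ω ∂P, ∀ (t : ℝ≥0) (i : Fin N ⊕ Fin N),
    x t ω i = x 0 ω i + (∫ s in (0 : ℝ)..t, (driftMatrix G *ᵥ x s.toNNReal ω) i)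
      + (noiseMatrix N *ᵥ fun k => W k t ω) i

end Graph

/-- `x₁ⱼ - x̄₁`: the deviation of the first-component state of vertex `j` from the average
`x̄₁ = (1/N) ∑ₖ x₁ₖ` over the network. -/
def deviation {N : ℕ} (z : Fin N ⊕ Fin N → ℝ) (j : Fin N) : ℝ :=
  z (Sum.inl j) - (1 / (N : ℝ)) * ∑ k : Fin N, z (Sum.inl k)

/-- `h` is the vertex variance `H_SO(j) = lim_{t → ∞} 𝔼[(x₁ⱼ(t) - x̄₁(t))²]`: the expectations
are finite, the limit exists, and it equals `h`. -/
def HasVertexVariance {N : ℕ} {Ω : Type*} [MeasurableSpace Ω]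
    (x : ℝ≥0 → Ω → (Fin N ⊕ Fin N → ℝ)) (P : Measure Ω) (j : Fin N) (h : ℝ) : Prop :=
  (∀ t, Integrable (fun ω => deviation (x t ω) j ^ 2) P) ∧
    Tendsto (fun t => ∫ ω, deviation (x t ω) j ^ 2 ∂P) atTop (𝓝 h)

end Consensus

end

/-!
The Laplacian `L` is symmetric, so the consensus dynamics decouple along an orthonormal basis of
eigenvectors `uᵢ` of `L`, with eigenvalues `λᵢ ≥ 0`. The mode `yᵢ = ⟨uᵢ, x₁⟩` is a scalar damped
oscillator `y'' + λᵢ y' + λᵢ y = ⟨uᵢ, w⟩`, and the noises `⟨uᵢ, W⟩` are uncorrelated between modes.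
Since the graph is connected, the modes with `λᵢ = 0` are constant vectors, and passing to the
deviation from the average removes exactly these
(`Consensus.deviation_eq_sum_modeWeight`).

Let `φᵢ` be the impulse response of the `i`-th oscillator and `ψᵢ = φᵢ'`. Variation of constants,
integrated by parts so that only an ordinary time integral of the Brownian path occurs, gives
pathwise
`yᵢ(t) = (ψᵢ + λᵢ φᵢ)(t) yᵢ(0) + φᵢ(t) yᵢ'(0) + ∫₀ᵗ ψᵢ(t - s) ⟨uᵢ, W(s)⟩ ds`
(`Consensus.IsImpulseResponse.eq_add_integral`). By Fubini's theorem and the covariance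
`min s r` of Brownian motion, the last term has second moment `∫₀ᵗ φᵢ²`
(`Consensus.IsBrownianVector.memLp_two_and_integral_sq_filter`), so stochastic integrals are not
needed. If `λᵢ > 0`, a Lyapunov function shows that `φᵢ` and `ψᵢ` tend to zero, and another one
evaluates `∫₀^∞ φᵢ² = 1 / (2 λᵢ²)` (`Consensus.IsImpulseResponse.tendsto_integral_sq`).

The part of the deviation due to the initial state thus tends to zero in `L²`, hence does not affect
the limit of the second moments, whatever its dependence on the noise
(`Consensus.tendsto_integral_sq_add`). The limit is
`∑ᵢ uᵢ(j)² / (2 λᵢ²)` over the nonzero eigenvalues, that is `(1/2) (L†)²ⱼⱼ`. As the rows of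
`(L†)²` sum to zero, `D_B²(j) = N (L†)²ⱼⱼ + tr (L†)²` and `D_B²(G) = N tr (L†)²`, so this is the
asserted combination (`Consensus.biharmonic_index_combination_eq`).
-/

namespace Consensus

/-! ### The impulse response of a damped oscillator -/

/-- `φ` is the impulse response of the oscillator `y'' + lam * y' + lam * y = 0`, the solution with
`φ 0 = 0` and `φ' 0 = 1`, and `ψ` is its derivative. -/
structure IsImpulseResponse (lam : ℝ) (φ ψ : ℝ → ℝ) : Prop where
  left_zero : φ 0 = 0
  right_zero : ψ 0 = 1
  hasDerivAt_left : ∀ t, HasDerivAt φ (ψ t) t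
  hasDerivAt_right : ∀ t, HasDerivAt ψ (-lam * φ t - lam * ψ t) t

theorem exists_isImpulseResponse (lam : ℝ) : ∃ φ ψ : ℝ → ℝ, IsImpulseResponse lam φ ψ := by
  let M : ℝ × ℝ →L[ℝ] ℝ × ℝ :=
    (ContinuousLinearMap.snd ℝ ℝ ℝ).prod
      ((-lam) • ContinuousLinearMap.fst ℝ ℝ ℝ - lam • ContinuousLinearMap.snd ℝ ℝ ℝ)
  let v : ℝ → ℝ × ℝ := fun t => NormedSpace.exp (t • M) ((0 : ℝ), (1 : ℝ))
  have hv : ∀ t, HasDerivAt v (M (v t)) t := fun t =>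
    (hasDerivAt_exp_smul_const' (𝕂 := ℝ) M t).clm_apply (hasDerivAt_const t ((0 : ℝ), (1 : ℝ)))
      |>.congr_deriv (by simp [v])
  refine ⟨fun t => (v t).1, fun t => (v t).2, by simp [v], by simp [v], fun t => ?_, fun t => ?_⟩
  · exact (ContinuousLinearMap.fst ℝ ℝ ℝ).hasFDerivAt.comp_hasDerivAt t (hv t)
  · exact ((ContinuousLinearMap.snd ℝ ℝ ℝ).hasFDerivAt.comp_hasDerivAt t (hv t))

namespace IsImpulseResponse

variable {lam : ℝ} {φ ψ : ℝ → ℝ}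

theorem continuous_left (h : IsImpulseResponse lam φ ψ) : Continuous φ :=
  continuous_iff_continuousAt.2 fun t => (h.hasDerivAt_left t).continuousAt

theorem continuous_right (h : IsImpulseResponse lam φ ψ) : Continuous ψ :=
  continuous_iff_continuousAt.2 fun t => (h.hasDerivAt_right t).continuousAt

/-- The response and its derivative are dominated by a Lyapunov function `V` that tends to zero:
`V' = -(φ² + ψ²) ≤ -ε V` for some `ε > 0`, so that `V` decays exponentially. This covers the
under-, over- and critically damped cases at once. -/
theorem exists_tendsto_zero_bound (h : IsImpulseResponse lam φ ψ) (hlam : 0 < lam) :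
    ∃ V : ℝ → ℝ, Tendsto V atTop (𝓝 0) ∧
      (∀ t, φ t ^ 2 ≤ 2 * V t) ∧ ∀ t, ψ t ^ 2 ≤ 2 * lam * V t := by
  -- The coefficients solve the Lyapunov equation `V' = -(φ² + ψ²)`; completing the square in the
  -- mixed term makes positivity visible.
  set V : ℝ → ℝ := fun t => 1 / 2 * (φ t + ψ t / lam) ^ 2
    + (1 / 2 + 1 / (2 * lam)) * φ t ^ 2 + 1 / (2 * lam) * ψ t ^ 2 with hV
  set ε : ℝ := (2 + 2 / lam + 1 / lam ^ 2)⁻¹ with hε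
  have hεpos : 0 < ε := by positivity
  have hV' : ∀ t, HasDerivAt V (-(φ t ^ 2 + ψ t ^ 2)) t := fun t => by
    have hφ := h.hasDerivAt_left t
    have hψ := h.hasDerivAt_right t
    have := ((((hφ.add (hψ.div_const lam)).pow 2).const_mul (1 / 2)).add
      ((hφ.pow 2).const_mul (1 / 2 + 1 / (2 * lam)))).add ((hψ.pow 2).const_mul (1 / (2 * lam)))
    refine this.congr_deriv ?_
    simp only [Pi.add_apply, Nat.add_one_sub_one, pow_one]
    field_simp
    push_cast
    ring
  have hVnonneg : ∀ t, 0 ≤ V t := fun t => by positivity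
  have hVle : ∀ t, ε * V t ≤ φ t ^ 2 + ψ t ^ 2 := fun t => by
    rw [hε, inv_mul_le_iff₀ (by positivity)]
    have h1 : (φ t + ψ t / lam) ^ 2 ≤ 2 * φ t ^ 2 + 2 * (1 / lam ^ 2 * ψ t ^ 2) := by
      have : (ψ t / lam) ^ 2 = 1 / lam ^ 2 * ψ t ^ 2 := by field_simp
      nlinarith [sq_nonneg (φ t - ψ t / lam)]
    have h2 : 0 ≤ 1 / lam * φ t ^ 2 := by positivity
    have h3 : 0 ≤ 1 / lam * ψ t ^ 2 := by positivity
    have h4 : 0 ≤ 1 / lam ^ 2 * φ t ^ 2 := by positivity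
    have e1 : 1 / (2 * lam) = 1 / 2 * (1 / lam) := by field_simp
    have e2 : 2 / lam = 2 * (1 / lam) := by ring
    simp only [hV]
    rw [e1, e2]
    nlinarith [sq_nonneg (φ t), sq_nonneg (ψ t)]
  have hanti : Antitone fun t => Real.exp (ε * t) * V t := by
    refine antitone_of_hasDerivAt_nonpos (fun t =>
      ((((hasDerivAt_id t).const_mul ε).exp).mul (hV' t))) fun t => ?_
    have : 0 < Real.exp (ε * t) := Real.exp_pos _
    simp only [id, mul_one, Pi.zero_apply]
    nlinarith [mul_le_mul_of_nonneg_left (hVle t) this.le]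
  refine ⟨V, ?_, fun t => ?_, fun t => ?_⟩
  · have hlim : Tendsto (fun t => V 0 * Real.exp (-(ε * t))) atTop (𝓝 0) := by
      have := (Real.tendsto_exp_neg_atTop_nhds_zero.comp
        (tendsto_id.const_mul_atTop hεpos)).const_mul (V 0)
      rwa [mul_zero] at this
    refine squeeze_zero' (Eventually.of_forall hVnonneg) ?_ hlim
    filter_upwards [eventually_ge_atTop 0] with t ht
    have := hanti ht
    simp only [mul_zero, Real.exp_zero, one_mul] at this
    rw [Real.exp_neg, ← div_eq_mul_inv, le_div_iff₀ (Real.exp_pos _)]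
    linarith
  · have h1 : 0 ≤ 1 / (2 * lam) * φ t ^ 2 := by positivity
    have h2 : 0 ≤ 1 / (2 * lam) * ψ t ^ 2 := by positivity
    simp only [hV]
    nlinarith [sq_nonneg (φ t + ψ t / lam)]
  · have h1 : 0 ≤ (1 / 2 + 1 / (2 * lam)) * φ t ^ 2 := by positivity
    calc ψ t ^ 2 = 2 * lam * (1 / (2 * lam) * ψ t ^ 2) := by field_simp
      _ ≤ 2 * lam * V t := by
        gcongr
        simp only [hV]
        nlinarith [sq_nonneg (φ t + ψ t / lam)]

theorem _root_.Filter.Tendsto.zero_of_sq {f : ℝ → ℝ} {l : Filter ℝ}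
    (hf : Tendsto (fun t => f t ^ 2) l (𝓝 0)) : Tendsto f l (𝓝 0) := by
  have := hf.sqrt
  simp only [Real.sqrt_sq_eq_abs, Real.sqrt_zero] at this
  exact (tendsto_zero_iff_abs_tendsto_zero f).2 this

theorem tendsto_left (h : IsImpulseResponse lam φ ψ) (hlam : 0 < lam) :
    Tendsto φ atTop (𝓝 0) := by
  obtain ⟨V, hV, h1, -⟩ := h.exists_tendsto_zero_bound hlam
  refine (squeeze_zero (fun t => sq_nonneg _) h1 ?_).zero_of_sq
  simpa using hV.const_mul 2

theorem tendsto_right (h : IsImpulseResponse lam φ ψ) (hlam : 0 < lam) :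
    Tendsto ψ atTop (𝓝 0) := by
  obtain ⟨V, hV, -, h2⟩ := h.exists_tendsto_zero_bound hlam
  refine (squeeze_zero (fun t => sq_nonneg _) h2 ?_).zero_of_sq
  simpa using hV.const_mul (2 * lam)

/-- The energy of the impulse response. The quadratic form `Q` in the proof solves the Lyapunov
equation `Q' = -φ²`, so that the energy on `[0, t]` is `Q 0 - Q t`. -/
theorem tendsto_integral_sq (h : IsImpulseResponse lam φ ψ) (hlam : 0 < lam) :
    Tendsto (fun t => ∫ s in (0 : ℝ)..t, φ s ^ 2) atTop (𝓝 (1 / 2 * (lam⁻¹) ^ 2)) := by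
  set Q : ℝ → ℝ := fun t => 1 / 2 * (φ t + ψ t / lam) ^ 2 + 1 / (2 * lam) * φ t ^ 2 with hQ
  have hQ' : ∀ t, HasDerivAt Q (-(φ t ^ 2)) t := fun t => by
    have hφ := h.hasDerivAt_left t
    have hψ := h.hasDerivAt_right t
    have := (((hφ.add (hψ.div_const lam)).pow 2).const_mul (1 / 2)).add
      ((hφ.pow 2).const_mul (1 / (2 * lam)))
    refine this.congr_deriv ?_
    simp only [Pi.add_apply, Nat.add_one_sub_one, pow_one]
    field_simp
    push_cast
    ring
  have hint : ∀ t, ∫ s in (0 : ℝ)..t, φ s ^ 2 = Q 0 - Q t := fun t => by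
    have := intervalIntegral.integral_eq_sub_of_hasDerivAt (a := 0) (b := t)
      (fun s _ => hQ' s) ((h.continuous_left.pow 2).neg.intervalIntegrable _ _)
    rw [intervalIntegral.integral_neg] at this
    linarith
  have hlim : Tendsto Q atTop (𝓝 (1 / 2 * (0 + 0 / lam) ^ 2 + 1 / (2 * lam) * 0 ^ 2)) :=
    ((((h.tendsto_left hlam).add ((h.tendsto_right hlam).div_const lam)).pow 2).const_mul _).add
      (((h.tendsto_left hlam).pow 2).const_mul _)
  simp only [hint]
  convert tendsto_const_nhds.sub hlim using 2
  simp only [hQ, h.left_zero, h.right_zero]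
  ring

/-- Variation of constants for the oscillator driven by an arbitrary forcing `B`, written after an
integration by parts so that no integral against `dB` occurs. -/
theorem eq_add_integral (h : IsImpulseResponse lam φ ψ) {y z B : ℝ≥0 → ℝ}
    (hy : Continuous y) (hz : Continuous z)
    (hy_eq : ∀ t, y t = y 0 + ∫ s in (0 : ℝ)..t, z s.toNNReal)
    (hz_eq : ∀ t, z t = z 0 + (∫ s in (0 : ℝ)..t, -lam * (y s.toNNReal + z s.toNNReal)) + B t)
    (t : ℝ≥0) :
    y t = (ψ t + lam * φ t) * y 0 + φ t * z 0
      + ∫ s in (0 : ℝ)..t, ψ (t - s) * B s.toNNReal := by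
  have hyc : Continuous fun s : ℝ => y s.toNNReal := hy.comp continuous_real_toNNReal
  have hzc : Continuous fun s : ℝ => z s.toNNReal := hz.comp continuous_real_toNNReal
  have hyzc : Continuous fun s : ℝ => -lam * (y s.toNNReal + z s.toNNReal) :=
    continuous_const.mul (hyc.add hzc)
  -- `Y` and `Z` extend `y` and `z - B` to differentiable functions on the real line.
  set Y : ℝ → ℝ := fun u => y 0 + ∫ s in (0 : ℝ)..u, z s.toNNReal with hYdef
  set Z : ℝ → ℝ := fun u =>
    z 0 + ∫ s in (0 : ℝ)..u, -lam * (y s.toNNReal + z s.toNNReal) with hZdef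
  have hY : ∀ s, HasDerivAt Y (z s.toNNReal) s := fun s =>
    (hzc.integral_hasStrictDerivAt 0 s).hasDerivAt.const_add _
  have hZ : ∀ s, HasDerivAt Z (-lam * (y s.toNNReal + z s.toNNReal)) s := fun s =>
    (hyzc.integral_hasStrictDerivAt 0 s).hasDerivAt.const_add _
  have hYc : Continuous Y := continuous_iff_continuousAt.2 fun t => (hY t).continuousAt
  have hZc : Continuous Z := continuous_iff_continuousAt.2 fun t => (hZ t).continuousAt
  have hYy : ∀ s, 0 ≤ s → Y s = y s.toNNReal := fun s hs => by
    rw [hy_eq, Real.coe_toNNReal s hs]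
  have hZz : ∀ s, 0 ≤ s → Z s = z s.toNNReal - B s.toNNReal := fun s hs => by
    rw [hz_eq s.toNNReal, Real.coe_toNNReal s hs]
    ring
  have hsub : ∀ s, HasDerivAt (fun s : ℝ => (t : ℝ) - s) (-1) s := fun s =>
    (hasDerivAt_id s).const_sub _
  have hF : ∀ s ∈ Set.uIcc (0 : ℝ) t, HasDerivAt
      (fun s => (ψ (t - s) + lam * φ (t - s)) * Y s + φ (t - s) * Z s)
      (ψ (t - s) * (z s.toNNReal - Z s)) s := fun s hs => by
    have hs0 : 0 ≤ s := by
      rw [Set.uIcc_of_le t.coe_nonneg] at hs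
      exact hs.1
    have hφ := (h.hasDerivAt_left (t - s)).comp s (hsub s)
    have hψ := (h.hasDerivAt_right (t - s)).comp s (hsub s)
    have := ((hψ.add (hφ.const_mul lam)).mul (hY s)).add (hφ.mul (hZ s))
    refine this.congr_deriv ?_
    simp only [Pi.add_apply, Function.comp_apply]
    rw [hYy s hs0]
    ring
  have hψc : Continuous fun s : ℝ => ψ (t - s) :=
    h.continuous_right.comp (continuous_const.sub continuous_id)
  have key := intervalIntegral.integral_eq_sub_of_hasDerivAt hF
    ((hψc.mul (hzc.sub hZc)).intervalIntegrable _ _)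
  have hcongr : ∫ s in (0 : ℝ)..t, ψ (t - s) * (z s.toNNReal - Z s)
      = ∫ s in (0 : ℝ)..t, ψ (t - s) * B s.toNNReal := by
    refine intervalIntegral.integral_congr fun s hs => ?_
    rw [Set.uIcc_of_le t.coe_nonneg] at hs
    simp only [hZz s hs.1]
    ring
  rw [hcongr] at key
  have hY0 : Y 0 = y 0 := by simp [hYdef]
  have hZ0 : Z 0 = z 0 := by simp [hZdef]
  have hYt : Y t = y t := by simpa using hYy t t.coe_nonneg
  simp only [sub_self, sub_zero, h.left_zero, h.right_zero, hY0, hZ0, hYt] at key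
  linarith

end IsImpulseResponse

/-- The covariance of Brownian motion, tested against `g = G'`: two integrations by parts turn the
kernel `min s r` into an inner product of primitives. This is the Itô isometry for `G`. -/
theorem integral_integral_mul_min {G g : ℝ → ℝ} (hG : ∀ s, HasDerivAt G (g s) s)
    (hg : Continuous g) (hG0 : G 0 = 0) {t : ℝ} (ht : 0 ≤ t) :
    ∫ s in (0 : ℝ)..t, ∫ r in (0 : ℝ)..t, g (t - s) * g (t - r) * min s r
      = ∫ s in (0 : ℝ)..t, G s ^ 2 := by
  have hGc : Continuous G := continuous_iff_continuousAt.2 fun t => (hG t).continuousAt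
  have hsubc : Continuous fun s : ℝ => t - s := continuous_const.sub continuous_id
  have hG' : ∀ s, HasDerivAt (fun s => -G (t - s)) (g (t - s)) s := fun s => by
    have := ((hG (t - s)).comp s ((hasDerivAt_id s).const_sub t)).neg
    refine this.congr_deriv ?_
    ring
  have hgc : Continuous fun s => g (t - s) := hg.comp hsubc
  set H : ℝ → ℝ := fun s => ∫ r in (0 : ℝ)..s, G (t - r) with hH
  have hH' : ∀ s, HasDerivAt H (G (t - s)) s := fun s =>
    ((hGc.comp hsubc).integral_hasStrictDerivAt 0 s).hasDerivAt
  have inner : ∀ s ∈ Set.uIcc (0 : ℝ) t,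
      ∫ r in (0 : ℝ)..t, g (t - s) * g (t - r) * min s r = H s * g (t - s) := fun s hs => by
    rw [Set.uIcc_of_le ht] at hs
    have hcont : Continuous fun r => g (t - s) * g (t - r) * min s r := by fun_prop
    rw [← intervalIntegral.integral_add_adjacent_intervals (b := s)
      (hcont.intervalIntegrable _ _) (hcont.intervalIntegrable _ _)]
    have e1 : ∫ r in (0 : ℝ)..s, g (t - s) * g (t - r) * min s r
        = g (t - s) * ∫ r in (0 : ℝ)..s, r * g (t - r) := by
      rw [← intervalIntegral.integral_const_mul]
      refine intervalIntegral.integral_congr fun r hr => ?_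
      rw [Set.uIcc_of_le hs.1] at hr
      simp only [min_eq_right hr.2]
      ring
    have e2 : ∫ r in s..t, g (t - s) * g (t - r) * min s r
        = g (t - s) * s * ∫ r in s..t, g (t - r) := by
      rw [← intervalIntegral.integral_const_mul]
      refine intervalIntegral.integral_congr fun r hr => ?_
      rw [Set.uIcc_of_le hs.2] at hr
      simp only [min_eq_left hr.1]
      ring
    have e3 : ∫ r in (0 : ℝ)..s, r * g (t - r) = -(s * G (t - s)) + H s := by
      rw [intervalIntegral.integral_mul_deriv_eq_deriv_mul (fun r _ => hasDerivAt_id' r)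
        (fun r _ => hG' r) (continuous_const.intervalIntegrable _ _)
        (hgc.intervalIntegrable _ _)]
      simp only [one_mul, intervalIntegral.integral_neg, hH]
      ring
    have e4 : ∫ r in s..t, g (t - r) = G (t - s) := by
      rw [intervalIntegral.integral_eq_sub_of_hasDerivAt (fun r _ => hG' r)
        (hgc.intervalIntegrable _ _)]
      simp [hG0]
    rw [e1, e2, e3, e4]
    ring
  rw [intervalIntegral.integral_congr inner,
    intervalIntegral.integral_mul_deriv_eq_deriv_mul (fun r _ => hH' r)
      (fun r _ => hG' r) ((hGc.comp hsubc).intervalIntegrable _ _)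
      (hgc.intervalIntegrable _ _)]
  have h0 : H 0 = 0 := by simp [hH]
  have := intervalIntegral.integral_comp_sub_left (fun s => G s ^ 2) (a := 0) (b := t) t
  simp only [sub_self, sub_zero] at this
  rw [← this]
  simp only [sub_self, hG0, h0, mul_neg, intervalIntegral.integral_neg, pow_two]
  ring

/-! ### Second moments of time integrals of processes -/

section SecondMoments

variable {Ω : Type*} [MeasurableSpace Ω] {P : Measure Ω}

/-- A process with almost surely continuous paths is jointly measurable up to a null set: it is the
limit of its discretizations along the times `⌊n s⌋ / n`. -/
theorem aestronglyMeasurable_prod_of_ae_continuous {X : ℝ≥0 → Ω → ℝ} [SFinite P]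
    (hX : ∀ t, AEMeasurable (X t) P) (hcont : ∀ᵐ ω ∂P, Continuous fun t => X t ω)
    (ν : Measure ℝ) [SFinite ν] :
    AEStronglyMeasurable (fun p : Ω × ℝ => X p.2.toNNReal p.1) (P.prod ν) := by
  -- Only the countably many times `m / n` matter, so measurable versions can be fixed there.
  obtain ⟨M, hM, hXM⟩ : ∃ M : ℕ → ℕ → Ω → ℝ, (∀ n m, Measurable (M n m)) ∧
      ∀ n m : ℕ, X ((m : ℝ≥0) / (n : ℝ≥0)) =ᵐ[P] M n m :=
    ⟨fun n m => (hX ((m : ℝ≥0) / (n : ℝ≥0))).mk _, fun n m => (hX _).measurable_mk,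
      fun n m => (hX _).ae_eq_mk⟩
  have hY : ∀ n : ℕ, Measurable fun p : Ω × ℝ => M n ⌊(p.2.toNNReal : ℝ) * n⌋₊ p.1 :=
    fun n => by
      have h1 : Measurable fun p : Ω × ℕ => M n p.2 p.1 :=
        measurable_from_prod_countable_left fun m => hM n m
      have h2 : Measurable fun p : Ω × ℝ => (p.1, ⌊(p.2.toNNReal : ℝ) * n⌋₊) :=
        measurable_fst.prodMk
          (Nat.measurable_floor.comp
            ((measurable_real_toNNReal.comp measurable_snd).coe_nnreal_real.mul_const _))
      exact h1.comp h2
  have hmk : ∀ᵐ ω ∂P, ∀ n m : ℕ, X ((m : ℝ≥0) / (n : ℝ≥0)) ω = M n m ω :=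
    ae_all_iff.2 fun n => ae_all_iff.2 fun m => hXM n m
  have hfst : ∀ᵐ p ∂P.prod ν, (Continuous fun t => X t p.1) ∧
      ∀ n m : ℕ, X ((m : ℝ≥0) / (n : ℝ≥0)) p.1 = M n m p.1 :=
    Measure.quasiMeasurePreserving_fst.ae (hcont.and hmk)
  refine (aemeasurable_of_tendsto_metrizable_ae atTop (fun n => (hY n).aemeasurable)
    ?_).aestronglyMeasurable
  filter_upwards [hfst] with p hp
  have hq : Tendsto (fun n : ℕ => ((⌊(p.2.toNNReal : ℝ) * n⌋₊ : ℕ) : ℝ≥0) / (n : ℝ≥0)) atTop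
      (𝓝 p.2.toNNReal) := by
    rw [← NNReal.tendsto_coe]
    push_cast
    exact (tendsto_nat_floor_mul_div_atTop p.2.toNNReal.coe_nonneg).comp
      tendsto_natCast_atTop_atTop
  exact ((hp.1.tendsto _).comp hq).congr fun n => hp.2 n _

/-- The second moment of a time integral is the double integral of the covariances. -/
theorem memLp_two_integral_and_integral_sq [IsFiniteMeasure P] {ν : Measure ℝ} [IsFiniteMeasure ν]
    {h : ℝ → Ω → ℝ}
    (hmeas : AEStronglyMeasurable (fun p : Ω × ℝ => h p.2 p.1) (P.prod ν))
    (hL2 : ∀ s, MemLp (h s) 2 P) {C : ℝ} (hC : ∀ᵐ s ∂ν, ∫ ω, h s ω ^ 2 ∂P ≤ C) :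
    MemLp (fun ω => ∫ s, h s ω ∂ν) 2 P ∧
      ∫ ω, (∫ s, h s ω ∂ν) ^ 2 ∂P = ∫ s, ∫ r, (∫ ω, h s ω * h r ω ∂P) ∂ν ∂ν := by
  have hm1 : AEStronglyMeasurable (fun p : Ω × (ℝ × ℝ) => h p.2.1 p.1) (P.prod (ν.prod ν)) :=
    hmeas.comp_quasiMeasurePreserving
      (QuasiMeasurePreserving.prodMap (.id P) Measure.quasiMeasurePreserving_fst)
  have hm2 : AEStronglyMeasurable (fun p : Ω × (ℝ × ℝ) => h p.2.2 p.1) (P.prod (ν.prod ν)) :=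
    hmeas.comp_quasiMeasurePreserving
      (QuasiMeasurePreserving.prodMap (.id P) Measure.quasiMeasurePreserving_snd)
  have hm : AEStronglyMeasurable (fun p : Ω × (ℝ × ℝ) => h p.2.1 p.1 * h p.2.2 p.1)
      (P.prod (ν.prod ν)) := hm1.mul hm2
  have hint : Integrable (fun p : Ω × (ℝ × ℝ) => h p.2.1 p.1 * h p.2.2 p.1)
      (P.prod (ν.prod ν)) := by
    rw [integrable_prod_iff' hm]
    refine ⟨Eventually.of_forall fun y => (hL2 y.1).integrable_mul (hL2 y.2), ?_⟩
    have hC1 : ∀ᵐ y ∂ν.prod ν, ∫ ω, h y.1 ω ^ 2 ∂P ≤ C :=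
      Measure.quasiMeasurePreserving_fst.ae hC
    have hC2 : ∀ᵐ y ∂ν.prod ν, ∫ ω, h y.2 ω ^ 2 ∂P ≤ C :=
      Measure.quasiMeasurePreserving_snd.ae hC
    refine Integrable.of_bound (C := C) hm.norm.prod_swap.integral_prod_right' ?_
    filter_upwards [hC1, hC2] with y h1 h2
    rw [Real.norm_of_nonneg (integral_nonneg fun ω => norm_nonneg _)]
    calc ∫ ω, ‖h y.1 ω * h y.2 ω‖ ∂P
        ≤ ∫ ω, (1 / 2 * h y.1 ω ^ 2 + 1 / 2 * h y.2 ω ^ 2) ∂P := by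
          refine integral_mono ((hL2 y.1).integrable_mul (hL2 y.2)).norm
            (((hL2 y.1).integrable_sq.const_mul _).add ((hL2 y.2).integrable_sq.const_mul _))
            fun ω => ?_
          simp only [norm_mul, Real.norm_eq_abs]
          nlinarith [sq_nonneg (|h y.1 ω| - |h y.2 ω|), sq_abs (h y.1 ω), sq_abs (h y.2 ω)]
      _ = 1 / 2 * ∫ ω, h y.1 ω ^ 2 ∂P + 1 / 2 * ∫ ω, h y.2 ω ^ 2 ∂P := by
          rw [integral_add ((hL2 y.1).integrable_sq.const_mul _)
            ((hL2 y.2).integrable_sq.const_mul _), integral_const_mul, integral_const_mul]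
      _ ≤ C := by linarith
  have hsq : ∀ ω, (∫ s, h s ω ∂ν) ^ 2 = ∫ y : ℝ × ℝ, h y.1 ω * h y.2 ω ∂ν.prod ν := fun ω => by
    rw [integral_prod_mul (fun s => h s ω) (fun s => h s ω), pow_two]
  constructor
  · rw [memLp_two_iff_integrable_sq hmeas.integral_prod_right']
    simp only [hsq]
    exact hint.integral_prod_left
  · simp only [hsq]
    rw [integral_integral_swap hint, integral_prod _ hint.integral_prod_right]

theorem norm_toLp_two_sq {f : Ω → ℝ} (hf : MemLp f 2 P) :
    ‖hf.toLp f‖ ^ 2 = ∫ ω, f ω ^ 2 ∂P := by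
  rw [← real_inner_self_eq_norm_sq, L2.inner_def]
  refine integral_congr_ae ?_
  filter_upwards [hf.coeFn_toLp] with ω hω
  simp [hω, pow_two]

/-- A perturbation that tends to zero in `L²` does not change the limit of the second moments. No
independence is needed. -/
theorem tendsto_integral_sq_add {ι : Type*} {l : Filter ι} {f g : ι → Ω → ℝ} {a : ℝ}
    (hf : ∀ t, MemLp (f t) 2 P) (hg : ∀ t, MemLp (g t) 2 P)
    (hf0 : Tendsto (fun t => ∫ ω, f t ω ^ 2 ∂P) l (𝓝 0))
    (hga : Tendsto (fun t => ∫ ω, g t ω ^ 2 ∂P) l (𝓝 a)) :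
    Tendsto (fun t => ∫ ω, (f t ω + g t ω) ^ 2 ∂P) l (𝓝 a) := by
  simp only [← norm_toLp_two_sq (hf _)] at hf0
  simp only [← norm_toLp_two_sq (hg _)] at hga
  have hnf : Tendsto (fun t => ‖(hf t).toLp (f t)‖) l (𝓝 0) := by
    simpa using hf0.sqrt
  have hng : Tendsto (fun t => ‖(hg t).toLp (g t)‖) l (𝓝 √a) := by
    simpa using hga.sqrt
  have hsum : Tendsto (fun t => ‖(hf t).toLp (f t) + (hg t).toLp (g t)‖
      - ‖(hg t).toLp (g t)‖) l (𝓝 0) := by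
    refine squeeze_zero_norm (fun t => ?_) hnf
    simpa using abs_norm_sub_norm_le ((hf t).toLp (f t) + (hg t).toLp (g t)) ((hg t).toLp (g t))
  have ha : Tendsto (fun t => ‖(hg t).toLp (g t)‖ ^ 2
      + ((‖(hf t).toLp (f t) + (hg t).toLp (g t)‖ - ‖(hg t).toLp (g t)‖) ^ 2
        + 2 * ‖(hg t).toLp (g t)‖
          * (‖(hf t).toLp (f t) + (hg t).toLp (g t)‖ - ‖(hg t).toLp (g t)‖))) l
      (𝓝 (a + (0 ^ 2 + 2 * √a * 0))) :=
    hga.add ((hsum.pow 2).add ((hng.const_mul 2).mul hsum))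
  have heq : a + (0 ^ 2 + 2 * √a * 0) = a := by ring
  rw [heq] at ha
  refine ha.congr fun t => ?_
  have := norm_toLp_two_sq ((hf t).add (hg t))
  rw [MemLp.toLp_add (hf t) (hg t)] at this
  simp only [Pi.add_apply] at this
  rw [← this]
  ring

theorem tendsto_integral_sq_sum_mul {ι T : Type*} [Fintype ι] {l : Filter T} {c : T → ι → ℝ}
    {ξ : ι → Ω → ℝ} (hξ : ∀ i, MemLp (ξ i) 2 P) (hc : ∀ i, Tendsto (fun t => c t i) l (𝓝 0)) :
    Tendsto (fun t => ∫ ω, (∑ i, c t i * ξ i ω) ^ 2 ∂P) l (𝓝 0) := by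
  have hexp : ∀ t, ∫ ω, (∑ i, c t i * ξ i ω) ^ 2 ∂P
      = ∑ i, ∑ k, c t i * c t k * ∫ ω, ξ i ω * ξ k ω ∂P := fun t => by
    simp only [pow_two, Finset.sum_mul_sum]
    have hI : ∀ i k, Integrable (fun ω => c t i * ξ i ω * (c t k * ξ k ω)) P := fun i k =>
      ((hξ i).const_mul _).integrable_mul ((hξ k).const_mul _)
    rw [integral_finsetSum _ fun i _ => integrable_finsetSum _ fun k _ => hI i k]
    refine Finset.sum_congr rfl fun i _ => ?_
    rw [integral_finsetSum _ fun k _ => hI i k]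
    refine Finset.sum_congr rfl fun k _ => ?_
    rw [← integral_const_mul]
    congr 1
    funext ω
    ring
  simp only [hexp]
  have := tendsto_finsetSum (f := fun i t => ∑ k, c t i * c t k * ∫ ω, ξ i ω * ξ k ω ∂P)
    (x := l) (a := fun _ => 0) Finset.univ fun i _ => by
      have := tendsto_finsetSum (f := fun k t => c t i * c t k * ∫ ω, ξ i ω * ξ k ω ∂P)
        (x := l) (a := fun _ => 0) Finset.univ fun k _ => by
          simpa using ((hc i).mul (hc k)).mul_const (∫ ω, ξ i ω * ξ k ω ∂P)
      simpa using this
  simpa using this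

end SecondMoments

/-! ### Brownian vectors in an orthonormal frame -/

section Brownian

variable {N : ℕ} {Ω : Type*} [MeasurableSpace Ω] {P : Measure Ω}
  {W : Fin N → ℝ≥0 → Ω → ℝ}

theorem IsBrownianVector.memLp_two (hW : IsBrownianVector W P) (k : Fin N) (t : ℝ≥0) :
    MemLp (W k t) 2 P :=
  ((hW.isBrownian k).hasLaw_eval t).hasGaussianLaw.memLp_two

theorem IsBrownianVector.integral_mul (hW : IsBrownianVector W P) (k l : Fin N) (s r : ℝ≥0) :
    ∫ ω, W k s ω * W l r ω ∂P = if k = l then ((min s r : ℝ≥0) : ℝ) else 0 := by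
  have : IsProbabilityMeasure P := ((hW.isBrownian k).hasLaw_eval s).isProbabilityMeasure
  split_ifs with hkl
  · subst hkl
    rw [← (hW.isBrownian k).covariance_eval s r,
      covariance_eq_sub (hW.memLp_two k s) (hW.memLp_two k r)]
    simp [(hW.isBrownian k).integral_eval]
  · have hind : IndepFun (W k s) (W l r) P :=
      (hW.indep.indepFun hkl).comp (φ := fun f : ℝ≥0 → ℝ => f s) (ψ := fun f : ℝ≥0 → ℝ => f r)
        (measurable_pi_apply s) (measurable_pi_apply r)
    have := hind.integral_mul_eq_mul_integral (hW.memLp_two k s).aestronglyMeasurable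
      (hW.memLp_two l r).aestronglyMeasurable
    simpa [(hW.isBrownian k).integral_eval] using this

/-- The coordinates of a Brownian vector in an orthonormal frame `u` are uncorrelated. -/
theorem IsBrownianVector.integral_sum_mul_sum (hW : IsBrownianVector W P) {ι : Type*}
    [DecidableEq ι] {u : ι → Fin N → ℝ}
    (hu : ∀ i m, ∑ k, u i k * u m k = if i = m then 1 else 0) (i m : ι) (s r : ℝ≥0) :
    ∫ ω, (∑ k, u i k * W k s ω) * (∑ l, u m l * W l r ω) ∂P
      = if i = m then ((min s r : ℝ≥0) : ℝ) else 0 := by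
  have hI : ∀ k l, Integrable (fun ω => u i k * W k s ω * (u m l * W l r ω)) P := fun k l =>
    ((hW.memLp_two k s).const_mul _).integrable_mul ((hW.memLp_two l r).const_mul _)
  simp only [Finset.sum_mul_sum]
  rw [integral_finsetSum _ fun k _ => integrable_finsetSum _ fun l _ => hI k l]
  have hkl : ∀ k l, ∫ ω, u i k * W k s ω * (u m l * W l r ω) ∂P
      = u i k * u m l * if k = l then ((min s r : ℝ≥0) : ℝ) else 0 := fun k l => by
    rw [← hW.integral_mul, ← integral_const_mul]
    congr 1
    funext ω
    ring
  have hk : ∀ k, ∫ ω, ∑ l, u i k * W k s ω * (u m l * W l r ω) ∂P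
      = u i k * u m k * ((min s r : ℝ≥0) : ℝ) := fun k => by
    rw [integral_finsetSum _ fun l _ => hI k l]
    simp [hkl]
  simp only [hk]
  rw [← Finset.sum_mul, hu]
  split_ifs <;> simp

/-- The Itô isometry for the noise filtered, mode by mode, through `ψ i = (φ i)'`. -/
theorem IsBrownianVector.memLp_two_and_integral_sq_filter (hW : IsBrownianVector W P)
    {ι : Type*} [Fintype ι] [DecidableEq ι] {u : ι → Fin N → ℝ}
    (hu : ∀ i m, ∑ k, u i k * u m k = if i = m then 1 else 0) (a : ι → ℝ)
    {φ ψ : ι → ℝ → ℝ} (hφ : ∀ i s, HasDerivAt (φ i) (ψ i s) s) (hψ : ∀ i, Continuous (ψ i))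
    (hφ0 : ∀ i, φ i 0 = 0) [IsProbabilityMeasure P] (t : ℝ≥0) :
    MemLp (fun ω => ∫ s in (0 : ℝ)..t,
        ∑ i, a i * (ψ i (t - s) * ∑ k, u i k * W k s.toNNReal ω)) 2 P ∧
      ∫ ω, (∫ s in (0 : ℝ)..t,
        ∑ i, a i * (ψ i (t - s) * ∑ k, u i k * W k s.toNNReal ω)) ^ 2 ∂P
        = ∑ i, a i ^ 2 * ∫ s in (0 : ℝ)..t, φ i s ^ 2 := by
  set h : ℝ → Ω → ℝ := fun s ω =>
    ∑ i, a i * (ψ i (t - s) * ∑ k, u i k * W k s.toNNReal ω) with hh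
  set ν : Measure ℝ := volume.restrict (Set.Ioc 0 (t : ℝ)) with hν
  have hsub : Measurable fun p : Ω × ℝ => (t : ℝ) - p.2 := measurable_const.sub measurable_snd
  have hmeas : AEStronglyMeasurable (fun p : Ω × ℝ => h p.2 p.1) (P.prod ν) := by
    refine Finset.aestronglyMeasurable_fun_sum _ fun i _ => AEStronglyMeasurable.const_mul
      (AEStronglyMeasurable.mul ((hψ i).measurable.comp hsub).aestronglyMeasurable
        (Finset.aestronglyMeasurable_fun_sum _ fun k _ => AEStronglyMeasurable.const_mul ?_ _)) _
    exact aestronglyMeasurable_prod_of_ae_continuous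
      (fun t => (hW.isBrownian k).aemeasurable t) (hW.isBrownian k).cont ν
  have hB : ∀ i s, MemLp (fun ω => ∑ k, u i k * W k s ω) 2 P := fun i s =>
    memLp_finsetSum _ fun k _ => (hW.memLp_two k s).const_mul _
  have hL2 : ∀ s, MemLp (h s) 2 P := fun s =>
    memLp_finsetSum _ fun i _ => ((hB i _).const_mul _).const_mul _
  have hK : ∀ s r, ∫ ω, h s ω * h r ω ∂P
      = ∑ i, a i ^ 2 * (ψ i (t - s) * ψ i (t - r)
        * ((min s.toNNReal r.toNNReal : ℝ≥0) : ℝ)) := fun s r => by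
    simp only [hh, Finset.sum_mul_sum]
    have hI : ∀ i m, Integrable (fun ω => a i * (ψ i (t - s) * ∑ k, u i k * W k s.toNNReal ω)
        * (a m * (ψ m (t - r) * ∑ k, u m k * W k r.toNNReal ω))) P := fun i m =>
      (((hB i _).const_mul _).const_mul _).integrable_mul (((hB m _).const_mul _).const_mul _)
    rw [integral_finsetSum _ fun i _ => integrable_finsetSum _ fun m _ => hI i m]
    refine Finset.sum_congr rfl fun i _ => ?_
    rw [integral_finsetSum _ fun m _ => hI i m]
    have him : ∀ m, ∫ ω, a i * (ψ i (t - s) * ∑ k, u i k * W k s.toNNReal ω)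
        * (a m * (ψ m (t - r) * ∑ k, u m k * W k r.toNNReal ω)) ∂P
        = a i * ψ i (t - s) * (a m * ψ m (t - r))
          * if i = m then ((min s.toNNReal r.toNNReal : ℝ≥0) : ℝ) else 0 := fun m => by
      rw [← hW.integral_sum_mul_sum hu, ← integral_const_mul]
      congr 1
      funext ω
      ring
    simp only [him, mul_ite, mul_zero, Finset.sum_ite_eq, Finset.mem_univ, if_true]
    ring
  have hmin : ∀ s ∈ Set.Ioc (0 : ℝ) t, ∀ r ∈ Set.Ioc (0 : ℝ) t,
      ((min s.toNNReal r.toNNReal : ℝ≥0) : ℝ) = min s r := fun s hs r hr => by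
    rw [NNReal.coe_min, Real.coe_toNNReal _ hs.1.le, Real.coe_toNNReal _ hr.1.le]
  obtain ⟨C, hC⟩ : ∃ C, ∀ s ∈ Set.Icc (0 : ℝ) t, ∫ ω, h s ω ^ 2 ∂P ≤ C := by
    have hcont : Continuous fun s => ∫ ω, h s ω ^ 2 ∂P := by
      simp only [pow_two, hK]
      have := fun i => (hψ i).comp ((continuous_const (y := (t : ℝ))).sub continuous_id)
      simp only [Function.comp_def] at this
      fun_prop
    obtain ⟨C, hC⟩ := isCompact_Icc.bddAbove_image hcont.continuousOn
    exact ⟨C, fun s hs => hC ⟨s, hs, rfl⟩⟩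
  have hC' : ∀ᵐ s ∂ν, ∫ ω, h s ω ^ 2 ∂P ≤ C :=
    (ae_restrict_mem measurableSet_Ioc).mono fun s hs => hC s (Set.Ioc_subset_Icc_self hs)
  have key := memLp_two_integral_and_integral_sq hmeas hL2 hC'
  simp only [intervalIntegral.integral_of_le t.coe_nonneg]
  refine ⟨key.1, key.2.trans ?_⟩
  have e1 : ∫ s, ∫ r, (∫ ω, h s ω * h r ω ∂P) ∂ν ∂ν
      = ∫ s in (0 : ℝ)..t, ∑ i, a i ^ 2 *
          ∫ r in (0 : ℝ)..t, ψ i (t - s) * ψ i (t - r) * min s r := by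
    rw [intervalIntegral.integral_of_le t.coe_nonneg]
    refine setIntegral_congr_fun measurableSet_Ioc fun s hs => ?_
    simp only [← intervalIntegral.integral_const_mul]
    rw [← intervalIntegral.integral_finsetSum]
    · rw [intervalIntegral.integral_of_le t.coe_nonneg]
      refine setIntegral_congr_fun measurableSet_Ioc fun r hr => ?_
      simp only [hK, hmin s hs r hr]
    · intro i _
      have := (hψ i).comp ((continuous_const (y := (t : ℝ))).sub continuous_id)
      simp only [Function.comp_def] at this
      exact Continuous.intervalIntegrable (by fun_prop) _ _
  rw [e1, intervalIntegral.integral_finsetSum]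
  · refine Finset.sum_congr rfl fun i _ => ?_
    rw [intervalIntegral.integral_const_mul,
      integral_integral_mul_min (hφ i) (hψ i) (hφ0 i) t.coe_nonneg,
      intervalIntegral.integral_of_le t.coe_nonneg]
  · intro i _
    have := (hψ i).comp ((continuous_const (y := (t : ℝ))).sub continuous_id)
    simp only [Function.comp_def] at this
    refine Continuous.intervalIntegrable (continuous_const.mul ?_) _ _
    exact intervalIntegral.continuous_parametric_intervalIntegral_of_continuous'
      (by fun_prop) _ _

end Brownian

/-! ### Eigenvectors of a symmetric matrix -/

section Eigenvectors

variable {n : Type*} [Fintype n] [DecidableEq n] {A : Matrix n n ℝ} (hA : A.IsHermitian)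

theorem sum_eigenvectorBasis_mul (i m : n) :
    ∑ k, hA.eigenvectorBasis i k * hA.eigenvectorBasis m k = if i = m then 1 else 0 := by
  have h : (star hA.eigenvectorUnitary : Matrix n n ℝ) *
      (hA.eigenvectorUnitary : Matrix n n ℝ) = 1 := Unitary.coe_star_mul_self _
  simpa [Matrix.mul_apply, Matrix.star_apply, Matrix.one_apply] using congrFun (congrFun h i) m

theorem sum_eigenvectorBasis_mul' (k l : n) :
    ∑ i, hA.eigenvectorBasis i k * hA.eigenvectorBasis i l = if k = l then 1 else 0 := by
  have h : (hA.eigenvectorUnitary : Matrix n n ℝ) *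
      (star hA.eigenvectorUnitary : Matrix n n ℝ) = 1 := Unitary.coe_mul_star_self _
  simpa [Matrix.mul_apply, Matrix.star_apply, Matrix.one_apply] using congrFun (congrFun h k) l

theorem spectralMatrix_apply (d : n → ℝ) (k l : n) :
    spectralMatrix hA d k l
      = ∑ i, d i * (hA.eigenvectorBasis i k * hA.eigenvectorBasis i l) := by
  rw [spectralMatrix, Matrix.mul_apply]
  simp only [Matrix.mul_diagonal, Matrix.star_apply,
    Matrix.IsHermitian.eigenvectorUnitary_apply, star_trivial]
  exact Finset.sum_congr rfl fun i _ => by ring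

theorem sum_eigenvectorBasis_mul_mulVec (x : n → ℝ) (i : n) :
    ∑ k, hA.eigenvectorBasis i k * (A *ᵥ x) k
      = hA.eigenvalues i * ∑ k, hA.eigenvectorBasis i k * x k := by
  have hT : Aᵀ = A := by
    rw [← Matrix.conjTranspose_eq_transpose_of_trivial]
    exact hA
  have h : (hA.eigenvectorBasis i).ofLp ⬝ᵥ (A *ᵥ x)
      = (A *ᵥ (hA.eigenvectorBasis i).ofLp) ⬝ᵥ x := by
    rw [Matrix.dotProduct_mulVec, ← Matrix.mulVec_transpose, hT]
  rw [hA.mulVec_eigenvectorBasis, smul_dotProduct] at h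
  exact h

theorem sum_eigenvectorBasis_mul_sum (x : n → ℝ) (l : n) :
    ∑ i, hA.eigenvectorBasis i l * ∑ k, hA.eigenvectorBasis i k * x k = x l := by
  simp only [Finset.mul_sum, ← mul_assoc]
  rw [Finset.sum_comm]
  simp only [← Finset.sum_mul, sum_eigenvectorBasis_mul' hA]
  simp

end Eigenvectors

/-! ### Laplacian modes and the biharmonic indices -/

section Laplacian

variable {N : ℕ} (G : SimpleGraph (Fin N)) [DecidableRel G.Adj]

/-- The eigenvalue of the `i`-th mode of the Laplacian. -/
noncomputable def modeValue (i : Fin N) : ℝ :=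
  (G.posSemidef_lapMatrix ℝ).isHermitian.eigenvalues i

/-- The `i`-th vector of an orthonormal basis of eigenvectors of the Laplacian. -/
noncomputable def modeVector (i k : Fin N) : ℝ :=
  (G.posSemidef_lapMatrix ℝ).isHermitian.eigenvectorBasis i k

/-- The weight with which the `i`-th mode contributes to the deviation of vertex `j` from the
average: the `j`-th entry of the mode, or `0` if the mode is constant. -/
noncomputable def modeWeight (j i : Fin N) : ℝ :=
  if modeValue G i = 0 then 0 else modeVector G i j

theorem modeValue_nonneg (i : Fin N) : 0 ≤ modeValue G i :=
  (G.posSemidef_lapMatrix ℝ).eigenvalues_nonneg i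

theorem sum_modeVector_mul (i m : Fin N) :
    ∑ k, modeVector G i k * modeVector G m k = if i = m then 1 else 0 :=
  sum_eigenvectorBasis_mul _ i m

theorem sum_modeVector_mul_lapMatrix (x : Fin N → ℝ) (i : Fin N) :
    ∑ k, modeVector G i k * (G.lapMatrix ℝ *ᵥ x) k
      = modeValue G i * ∑ k, modeVector G i k * x k :=
  sum_eigenvectorBasis_mul_mulVec _ x i

theorem sum_modeVector_eq_zero {i : Fin N} (hi : modeValue G i ≠ 0) :
    ∑ k, modeVector G i k = 0 := by
  have h := sum_modeVector_mul_lapMatrix G (fun _ => 1) i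
  rw [G.lapMatrix_mulVec_const_eq_zero] at h
  simpa [hi] using h

theorem modeVector_eq_of_modeValue_eq_zero (hG : G.Connected) {i : Fin N}
    (hi : modeValue G i = 0) (j k : Fin N) : modeVector G i j = modeVector G i k := by
  have hA := (G.posSemidef_lapMatrix ℝ).isHermitian
  have h : G.lapMatrix ℝ *ᵥ (hA.eigenvectorBasis i).ofLp = 0 := by
    rw [hA.mulVec_eigenvectorBasis]
    exact (congrArg (· • _) hi).trans (zero_smul _ _)
  exact (G.lapMatrix_mulVec_eq_zero_iff_forall_reachable.1 h) j k (hG.preconnected j k)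

/-- On a connected graph, subtracting the average removes exactly the kernel modes. -/
theorem deviation_eq_sum_modeWeight (hG : G.Connected) (z : Fin N ⊕ Fin N → ℝ) (j : Fin N) :
    deviation z j
      = ∑ i, modeWeight G j i * ∑ k, modeVector G i k * z (Sum.inl k) := by
  have hN : (N : ℝ) ≠ 0 := by
    have : Nonempty (Fin N) := hG.nonempty
    exact_mod_cast (Fin.pos_iff_nonempty.2 this).ne'
  have hw : ∀ i, modeWeight G j i
      = modeVector G i j - 1 / (N : ℝ) * ∑ l, modeVector G i l := fun i => by
    unfold modeWeight
    split_ifs with hi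
    · simp only [fun l => modeVector_eq_of_modeValue_eq_zero G hG hi l j]
      simp [hN]
    · rw [sum_modeVector_eq_zero G hi, mul_zero, sub_zero]
  have hexp : ∀ l, z (Sum.inl l)
      = ∑ i, modeVector G i l * ∑ k, modeVector G i k * z (Sum.inl k) := fun l =>
    (sum_eigenvectorBasis_mul_sum (G.posSemidef_lapMatrix ℝ).isHermitian
      (fun k => z (Sum.inl k)) l).symm
  have hsum : ∑ l, z (Sum.inl l)
      = ∑ i, (∑ l, modeVector G i l) * ∑ k, modeVector G i k * z (Sum.inl k) := by
    rw [Finset.sum_congr rfl fun l _ => hexp l, Finset.sum_comm]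
    simp only [Finset.sum_mul]
  rw [deviation, hsum, hexp j, Finset.mul_sum, ← Finset.sum_sub_distrib]
  refine Finset.sum_congr rfl fun i _ => ?_
  rw [hw]
  ring

theorem lapPinv_sq_apply (j k : Fin N) :
    (lapPinv G ^ 2) j k
      = ∑ i, ((modeValue G i)⁻¹) ^ 2 * (modeVector G i j * modeVector G i k) := by
  rw [pow_two, lapPinv, pinv, spectralMatrix_mul, spectralMatrix_apply]
  simp only [pow_two, modeValue, modeVector]

theorem sum_lapPinv_sq_apply (j : Fin N) : ∑ k, (lapPinv G ^ 2) j k = 0 := by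
  simp only [lapPinv_sq_apply]
  rw [Finset.sum_comm]
  refine Finset.sum_eq_zero fun i _ => ?_
  rw [← Finset.mul_sum, ← Finset.mul_sum]
  by_cases hi : modeValue G i = 0
  · simp [hi]
  · rw [sum_modeVector_eq_zero G hi, mul_zero, mul_zero]

theorem biharmonicVertexIndex_eq (j : Fin N) :
    biharmonicVertexIndex G j = N * (lapPinv G ^ 2) j j + ∑ k, (lapPinv G ^ 2) k k := by
  simp only [biharmonicVertexIndex, biharmonicDistSq, Finset.sum_sub_distrib,
    Finset.sum_add_distrib, ← Finset.mul_sum, sum_lapPinv_sq_apply]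
  simp

theorem biharmonicKirchhoffIndex_eq :
    biharmonicKirchhoffIndex G = N * ∑ k, (lapPinv G ^ 2) k k := by
  have hsymm : ∀ j k, biharmonicDistSq G j k = biharmonicDistSq G k j := fun j k => by
    have : (lapPinv G ^ 2) j k = (lapPinv G ^ 2) k j := by
      simp only [lapPinv_sq_apply, mul_comm (modeVector G _ j)]
    simp only [biharmonicDistSq, this]
    ring
  have hdiag : ∀ j, biharmonicDistSq G j j = 0 := fun j => by
    simp only [biharmonicDistSq]
    ring
  -- Each unordered pair is counted twice in the sum of the vertex indices.
  have hsplit : ∑ j, biharmonicVertexIndex G j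
      = biharmonicKirchhoffIndex G + biharmonicKirchhoffIndex G := by
    have hswap : biharmonicKirchhoffIndex G
        = ∑ j, ∑ k, if k < j then biharmonicDistSq G j k else 0 := by
      rw [Finset.sum_comm]
      simp only [biharmonicKirchhoffIndex, Finset.sum_filter, hsymm]
    nth_rewrite 2 [hswap]
    simp only [biharmonicKirchhoffIndex, biharmonicVertexIndex, Finset.sum_filter,
      ← Finset.sum_add_distrib]
    refine Finset.sum_congr rfl fun j _ => Finset.sum_congr rfl fun k _ => ?_
    rcases lt_trichotomy j k with h | h | h
    · simp [h, h.not_gt]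
    · simp [h, hdiag]
    · simp [h, h.not_gt]
  simp only [biharmonicVertexIndex_eq, Finset.sum_add_distrib, ← Finset.mul_sum] at hsplit
  simp only [Finset.sum_const, Finset.card_univ, Fintype.card_fin, nsmul_eq_mul] at hsplit
  linarith

/-- The combination of biharmonic indices in the variance formula is `(1/2) (L†)²ⱼⱼ`, summed here
over the modes of the Laplacian. -/
theorem biharmonic_index_combination_eq (hG : G.Connected) (j : Fin N) :
    1 / (2 * (N : ℝ)) * (biharmonicVertexIndex G j - 1 / (N : ℝ) * biharmonicKirchhoffIndex G)
      = ∑ i, modeWeight G j i ^ 2 * (1 / 2 * ((modeValue G i)⁻¹) ^ 2) := by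
  have hN : (N : ℝ) ≠ 0 := by
    have : Nonempty (Fin N) := hG.nonempty
    exact_mod_cast (Fin.pos_iff_nonempty.2 this).ne'
  have h : ∑ i, modeWeight G j i ^ 2 * (1 / 2 * ((modeValue G i)⁻¹) ^ 2)
      = 1 / 2 * (lapPinv G ^ 2) j j := by
    rw [lapPinv_sq_apply, Finset.mul_sum]
    refine Finset.sum_congr rfl fun i _ => ?_
    unfold modeWeight
    split_ifs with hi
    · simp [hi]
    · ring
  rw [h, biharmonicVertexIndex_eq, biharmonicKirchhoffIndex_eq]
  field_simp
  ring

end Laplacian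

/-! ### The consensus dynamics in Laplacian modes -/

section Dynamics

variable {N : ℕ} (G : SimpleGraph (Fin N)) [DecidableRel G.Adj] {Ω : Type*} [MeasurableSpace Ω]
  {P : Measure Ω} {W : Fin N → ℝ≥0 → Ω → ℝ} {x : ℝ≥0 → Ω → (Fin N ⊕ Fin N → ℝ)}

theorem driftMatrix_mulVec_inl (z : Fin N ⊕ Fin N → ℝ) (k : Fin N) :
    (driftMatrix G *ᵥ z) (Sum.inl k) = z (Sum.inr k) := by
  simp [driftMatrix, Matrix.fromBlocks_mulVec]

theorem driftMatrix_mulVec_inr (z : Fin N ⊕ Fin N → ℝ) (k : Fin N) :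
    (driftMatrix G *ᵥ z) (Sum.inr k)
      = -(G.lapMatrix ℝ *ᵥ fun l => z (Sum.inl l)) k
        - (G.lapMatrix ℝ *ᵥ fun l => z (Sum.inr l)) k := by
  simp [driftMatrix, Matrix.fromBlocks_mulVec, Matrix.neg_mulVec, Function.comp_def, sub_eq_add_neg]

theorem noiseMatrix_mulVec_inl (w : Fin N → ℝ) (k : Fin N) :
    (noiseMatrix N *ᵥ w) (Sum.inl k) = 0 := by
  simp [noiseMatrix, Matrix.fromRows_mulVec]

theorem noiseMatrix_mulVec_inr (w : Fin N → ℝ) (k : Fin N) :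
    (noiseMatrix N *ᵥ w) (Sum.inr k) = w k := by
  simp [noiseMatrix, Matrix.fromRows_mulVec]

/-- Each mode of a solution is a scalar noisy oscillator, solved by its impulse response. -/
theorem IsSolution.ae_mode_eq (hx : IsSolution G x W P) {φ ψ : Fin N → ℝ → ℝ}
    (hφ : ∀ i, IsImpulseResponse (modeValue G i) (φ i) (ψ i)) :
    ∀ᵐ ω ∂P, ∀ (t : ℝ≥0) (i : Fin N),
      ∑ k, modeVector G i k * x t ω (Sum.inl k)
        = (ψ i t + modeValue G i * φ i t) * (∑ k, modeVector G i k * x 0 ω (Sum.inl k))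
          + φ i t * (∑ k, modeVector G i k * x 0 ω (Sum.inr k))
          + ∫ s in (0 : ℝ)..t, ψ i (t - s) * ∑ k, modeVector G i k * W k s.toNNReal ω := by
  filter_upwards [hx.continuous_paths, hx.integral_eq] with ω hc heq t i
  have hci : ∀ m, Continuous fun t => x t ω m := fun m => (continuous_apply m).comp hc
  have hdc : ∀ m, Continuous fun s : ℝ => (driftMatrix G *ᵥ x s.toNNReal ω) m := fun m => by
    have hcr : Continuous fun s : ℝ => x s.toNNReal ω := hc.comp continuous_real_toNNReal
    exact (continuous_apply m).comp (continuous_const.matrix_mulVec hcr)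
  have hint : ∀ (t : ℝ≥0) (a : ℝ) m, IntervalIntegrable
      (fun s : ℝ => a * (driftMatrix G *ᵥ x s.toNNReal ω) m) volume 0 t := fun t a m =>
    (continuous_const.mul (hdc m)).intervalIntegrable _ _
  refine (hφ i).eq_add_integral (y := fun t => ∑ k, modeVector G i k * x t ω (Sum.inl k))
    (z := fun t => ∑ k, modeVector G i k * x t ω (Sum.inr k))
    (B := fun t => ∑ k, modeVector G i k * W k t ω)
    (continuous_finsetSum _ fun k _ => continuous_const.mul (hci _))
    (continuous_finsetSum _ fun k _ => continuous_const.mul (hci _))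
    (fun t => ?_) (fun t => ?_) t
  · rw [Finset.sum_congr rfl fun k _ => congrArg (modeVector G i k * ·) (heq t (Sum.inl k))]
    simp only [noiseMatrix_mulVec_inl, add_zero, mul_add, Finset.sum_add_distrib]
    congr 1
    simp only [← intervalIntegral.integral_const_mul]
    rw [← intervalIntegral.integral_finsetSum fun k _ => hint t _ _]
    simp only [driftMatrix_mulVec_inl]
  · rw [Finset.sum_congr rfl fun k _ => congrArg (modeVector G i k * ·) (heq t (Sum.inr k))]
    simp only [noiseMatrix_mulVec_inr, mul_add, Finset.sum_add_distrib]
    congr 2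
    simp only [← intervalIntegral.integral_const_mul]
    rw [← intervalIntegral.integral_finsetSum fun k _ => hint t _ _]
    refine intervalIntegral.integral_congr fun s _ => ?_
    simp only [driftMatrix_mulVec_inr, mul_sub, mul_neg, Finset.sum_sub_distrib,
      Finset.sum_neg_distrib, sum_modeVector_mul_lapMatrix]
    ring

/-- The deviation splits into the response to the initial state and the filtered noise. -/
theorem IsSolution.ae_deviation_eq (hx : IsSolution G x W P) (hW : IsBrownianVector W P)
    (hG : G.Connected) {φ ψ : Fin N → ℝ → ℝ}
    (hφ : ∀ i, IsImpulseResponse (modeValue G i) (φ i) (ψ i)) (j : Fin N) :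
    ∀ᵐ ω ∂P, ∀ t : ℝ≥0, deviation (x t ω) j
      = (∑ m : Fin N ⊕ Fin N,
          Sum.elim (fun i => modeWeight G j i * (ψ i t + modeValue G i * φ i t))
              (fun i => modeWeight G j i * φ i t) m
            * Sum.elim (fun i => ∑ k, modeVector G i k * x 0 ω (Sum.inl k))
              (fun i => ∑ k, modeVector G i k * x 0 ω (Sum.inr k)) m)
        + ∫ s in (0 : ℝ)..t, ∑ i, modeWeight G j i
            * (ψ i (t - s) * ∑ k, modeVector G i k * W k s.toNNReal ω) := by
  have hWc : ∀ᵐ ω ∂P, ∀ k, Continuous fun t => W k t ω :=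
    ae_all_iff.2 fun k => (hW.isBrownian k).cont
  filter_upwards [hx.ae_mode_eq G hφ, hWc] with ω hmode hc t
  have hint : ∀ i, Continuous fun s : ℝ => modeWeight G j i
      * (ψ i (t - s) * ∑ k, modeVector G i k * W k s.toNNReal ω) := fun i => by
    have h1 : Continuous fun s : ℝ => ψ i (t - s) :=
      (hφ i).continuous_right.comp (continuous_const.sub continuous_id)
    have h2 : ∀ k, Continuous fun s : ℝ => W k s.toNNReal ω := fun k =>
      (hc k).comp continuous_real_toNNReal
    exact continuous_const.mul
      (h1.mul (continuous_finsetSum _ fun k _ => continuous_const.mul (h2 k)))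
  rw [deviation_eq_sum_modeWeight G hG, intervalIntegral.integral_finsetSum fun i _ =>
    (hint i).intervalIntegrable _ _, Fintype.sum_sum_type, ← Finset.sum_add_distrib,
    ← Finset.sum_add_distrib]
  refine Finset.sum_congr rfl fun i _ => ?_
  rw [hmode t i, intervalIntegral.integral_const_mul]
  simp only [Sum.elim_inl, Sum.elim_inr]
  ring

end Dynamics

end Consensus

theorem mainTheorem2 {N : ℕ} (G : SimpleGraph (Fin N)) [DecidableRel G.Adj] (hG : G.Connected)
    {Ω : Type*} [MeasurableSpace Ω] (P : Measure Ω) [IsProbabilityMeasure P]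
    (W : Fin N → ℝ≥0 → Ω → ℝ) (hW : Consensus.IsBrownianVector W P)
    (x : ℝ≥0 → Ω → (Fin N ⊕ Fin N → ℝ)) (hx : Consensus.IsSolution G x W P)
    (hx0 : ∀ i, MemLp (fun ω => x 0 ω i) 2 P) (j : Fin N) :
    Consensus.HasVertexVariance x P j
      (1 / (2 * (N : ℝ)) * (Consensus.biharmonicVertexIndex G j
        - 1 / (N : ℝ) * Consensus.biharmonicKirchhoffIndex G)) := by
  open Consensus in
  choose φ ψ hφ using fun i => exists_isImpulseResponse (modeValue G i)
  have hdev := hx.ae_deviation_eq G hW hG hφ j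
  set c : ℝ≥0 → Fin N ⊕ Fin N → ℝ := fun t =>
    Sum.elim (fun i => modeWeight G j i * (ψ i t + modeValue G i * φ i t))
      (fun i => modeWeight G j i * φ i t) with hc
  set ξ : Fin N ⊕ Fin N → Ω → ℝ := fun m ω =>
    Sum.elim (fun i => ∑ k, modeVector G i k * x 0 ω (Sum.inl k))
      (fun i => ∑ k, modeVector G i k * x 0 ω (Sum.inr k)) m
  set S : ℝ≥0 → Ω → ℝ := fun t ω => ∫ s in (0 : ℝ)..t, ∑ i, modeWeight G j i
    * (ψ i (t - s) * ∑ k, modeVector G i k * W k s.toNNReal ω)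
  have hξ : ∀ m, MemLp (ξ m) 2 P := by
    rintro (i | i)
    · exact memLp_finsetSum _ fun k _ => (hx0 (Sum.inl k)).const_mul _
    · exact memLp_finsetSum _ fun k _ => (hx0 (Sum.inr k)).const_mul _
  have hD : ∀ t, MemLp (fun ω => ∑ m, c t m * ξ m ω) 2 P := fun t =>
    memLp_finsetSum _ fun m _ => (hξ m).const_mul _
  have hS := fun t => hW.memLp_two_and_integral_sq_filter (sum_modeVector_mul G)
    (modeWeight G j) (fun i => (hφ i).hasDerivAt_left) (fun i => (hφ i).continuous_right)
    (fun i => (hφ i).left_zero) t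
  have hcoe : Tendsto (fun t : ℝ≥0 => (t : ℝ)) atTop atTop :=
    NNReal.tendsto_coe_atTop.2 tendsto_id
  -- Kernel modes have weight zero; every other mode is damped.
  have hmode : ∀ i, modeWeight G j i = 0 ∨ 0 < modeValue G i := fun i => by
    by_cases hi : modeValue G i = 0
    · exact Or.inl (if_pos hi)
    · exact Or.inr (lt_of_le_of_ne (modeValue_nonneg G i) (Ne.symm hi))
  have hc0 : ∀ m, Tendsto (fun t => c t m) atTop (𝓝 0) := by
    rintro (i | i)
    all_goals
      simp only [hc, Sum.elim_inl, Sum.elim_inr]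
      rcases hmode i with hi | hi
      · simp [hi]
    · have h1 := ((hφ i).tendsto_right hi).comp hcoe
      have h2 := ((hφ i).tendsto_left hi).comp hcoe
      simpa using (h1.add (h2.const_mul (modeValue G i))).const_mul (modeWeight G j i)
    · simpa using (((hφ i).tendsto_left hi).comp hcoe).const_mul (modeWeight G j i)
  have hSlim : Tendsto (fun t => ∫ ω, S t ω ^ 2 ∂P) atTop
      (𝓝 (∑ i, modeWeight G j i ^ 2 * (1 / 2 * ((modeValue G i)⁻¹) ^ 2))) := by
    refine Tendsto.congr (fun t => (hS t).2.symm) ?_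
    refine tendsto_finsetSum _ fun i _ => ?_
    rcases hmode i with hi | hi
    · simp [hi]
    · exact (((hφ i).tendsto_integral_sq hi).comp hcoe).const_mul _
  have hsq : ∀ t, (fun ω => (∑ m, c t m * ξ m ω + S t ω) ^ 2)
      =ᵐ[P] fun ω => deviation (x t ω) j ^ 2 := fun t => by
    filter_upwards [hdev] with ω hω
    rw [hω t]
  rw [biharmonic_index_combination_eq G hG j]
  refine ⟨fun t => ((hD t).add (hS t).1).integrable_sq.congr (hsq t), ?_⟩
  exact (tendsto_integral_sq_add hD (fun t => (hS t).1)
    (tendsto_integral_sq_sum_mul hξ hc0) hSlim).congr fun t => integral_congr_ae (hsq t)
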